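/- **Definitions.** A *pseudo effect algebra* (PEA) is a partial algebra $(E;+,0,1)$ such that for all $a,b,c\in E$: $a+b$ and $(a+b)+c$ exist iff $b+c$ and $a+(b+c)$ exist, and then $(a+b)+c=a+(b+c)$; there are exactly one $d$ and exactly one $e$ with $a+d=e+a=1$ (we write $a^\sim=d$, $a^-=e$); if $a+b$ exists, then $a+b=d+a=b+e$ for some $d,e\in E$; if $a+1$ or $1+a$ exists, then $a=0$. Put $a\le b$ iff $a+c=b$ for some $c\in E$. An isomorphism of PEAs is a bijection $f$ with $f(1)=1$ such that $f(a)+f(b)$ exists iff $a+b$ exists, and then $f(a)+f(b)=f(a+b)$. An *ideal* of $E$ is a non-empty set $I\subseteq E$ that is closed under existing sums and such that $a\le b\in I$ implies $a\in I$; a *maximal ideal* is one that is maximal among the ideals different from $E$. A *po-group* is a (not necessarily abelian) additively written group $G$ with a partial order such that $a\le b$ implies $x+a+y\le x+b+y$; $G^+=\{g\in G: g\ge 0\}$. It is *directed* if any two elements have a common upper bound, and *torsion-free* if $kg\neq 0$ for all $g\ne0$ and all integers $k\neq0$. A *strong unit* is an element $u\in G^+$ such that each $g\in G$ satisfies $g\le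 ku$ for some integer $k\ge1$; then $(G,u)$ is called *unital*. For $u\in G^+$, $\Gamma(G,u)=\{g\in G:0\le g\le u\}$ is a PEA with the restriction of the group addition and with constants $0,u$. $\mathbb Z\,\vec\times\, G$ is the group $\mathbb Z\times G$ with the lexicographic order: $(i,g)\le(j,h)$ iff $i<j$, or $i=j$ and $g\le h$. $E$ (respectively $G$) satisfies $\mathrm{RDP}_1$ if whenever $a_1+a_2=b_1+b_2$ in $E$ (respectively in $G$, with $a_1,a_2,b_1,b_2\in G^+$), there are $c_{11},c_{12},c_{21},c_{22}$ in $E$ (respectively in $G^+$) with $a_1=c_{11}+c_{12}$, $a_2=c_{21}+c_{22}$, $b_1=c_{11}+c_{21}$, $b_2=c_{12}+c_{22}$, and such that $0\le x\le c_{12}$ and $0\le y\le c_{21}$ imply $x+y=y+x$. Let $n\ge1$. An *$n$-decomposition* of $E$ is a system $(E_0,\dots,E_n)$ of pairwise disjoint subsets of $E$ with union $E$ such that $\{x^-:x\in E_i\}=\{x^\sim:x\in E_i\}=E_{n-i}$ for all $i$, and such that if $x\in E_i$, $y\in E_j$ and $x+y$ exists, then $i+j\le n$ and $x+y\in E_{i+j}$.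 $E$ is *$n$-perfect* if it has an $n$-decomposition $(E_0,\dots,E_n)$ such that $x+y$ exists whenever $x\in E_i$, $y\in E_j$ and $i+j<n$, and such that $E_0$ is a maximal ideal of $E$ and the only one. $E$ is *strong $n$-perfect* if it satisfies $\mathrm{RDP}_1$, is $n$-perfect with respect to some $n$-decomposition $(E_0,\dots,E_n)$, and, up to an isomorphism of PEAs, $E=\Gamma(H,u)$ for a torsion-free unital po-group $(H,u)$ such that some $c\in E_1$ satisfies $nc=u$ and $c+x=x+c$ for all $x\in H$. **Theorem.** Let $E$ be a pseudo effect algebra and let $n\ge1$ be an integer. Then $E$ is strong $n$-perfect if and only if there is a torsion-free directed po-group $G$ with $\mathrm{RDP}_1$ such that $E\cong\Gamma(\mathbb Z\,\vec\times\, G,(n,0))$. Moreover, $G$ is unique: any two torsion-free directed po-groups with $\mathrm{RDP}_1$ and with this property are isomorphic as po-groups. -/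

import Mathlib

universe u v w

/-- A pseudo effect algebra `(E; +, 0, 1)`. The partial addition is an `Option`-valued operation:
`padd a b = some c` means that `a + b` exists and equals `c`, and `padd a b = none` means that
`a + b` does not exist. -/
class PseudoEffectAlgebra (E : Type u) extends Zero E, One E where
  /-- the partial addition -/
  padd : E → E → Option E
  /-- `a + b` and `(a + b) + c` exist iff `b + c` and `a + (b + c)` exist, and then the two
  iterated sums agree. -/
  padd_assoc : ∀ a b c : E,
    ((padd a b).bind fun s => padd s c) = ((padd b c).bind fun t => padd a t)
  existsUnique_right : ∀ a : E, ∃! d, padd a d = some 1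
  existsUnique_left : ∀ a : E, ∃! e, padd e a = some 1
  padd_conj : ∀ a b s : E, padd a b = some s →
    (∃ d, padd d a = some s) ∧ ∃ e, padd b e = some s
  eq_zero_of_padd_one : ∀ a : E, (padd a 1).isSome ∨ (padd 1 a).isSome → a = 0

namespace PseudoEffectAlgebra

/-- The natural order: `a ≤ b` iff `a + c = b` for some `c`. -/
def Le {E : Type u} [PseudoEffectAlgebra E] (a b : E) : Prop :=
  ∃ c, padd a c = some b

/-- The property `RDP₁` of a pseudo effect algebra. -/
def RDP1 (E : Type u) [PseudoEffectAlgebra E] : Prop :=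
  ∀ a₁ a₂ b₁ b₂ s : E, padd a₁ a₂ = some s → padd b₁ b₂ = some s →
    ∃ c₁₁ c₁₂ c₂₁ c₂₂ : E,
      padd c₁₁ c₁₂ = some a₁ ∧ padd c₂₁ c₂₂ = some a₂ ∧
      padd c₁₁ c₂₁ = some b₁ ∧ padd c₁₂ c₂₂ = some b₂ ∧
      ∀ x y : E, Le x c₁₂ → Le y c₂₁ → padd x y = padd y x

/-- Ideals of a pseudo effect algebra. -/
structure IsIdeal {E : Type u} [PseudoEffectAlgebra E] (I : Set E) : Prop where
  nonempty : I.Nonempty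
  padd_mem : ∀ a ∈ I, ∀ b ∈ I, ∀ s, padd a b = some s → s ∈ I
  mem_of_le : ∀ a b, Le a b → b ∈ I → a ∈ I

/-- Maximal ideals: maximal among the proper ideals. -/
structure IsMaximalIdeal {E : Type u} [PseudoEffectAlgebra E] (I : Set E) : Prop where
  isIdeal : IsIdeal I
  ne_univ : I ≠ Set.univ
  eq_of_subset : ∀ J : Set E, IsIdeal J → J ≠ Set.univ → I ⊆ J → J = I

/-- An `n`-decomposition `(P 0, …, P n)` of `E`: a partition into `n + 1` slices that is compatible
with the two complements, `(P i)⁻ = (P i)^∼ = P (n - i)`, and with the partial addition. -/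
structure IsDecomposition {E : Type u} [PseudoEffectAlgebra E] (n : ℕ)
    (P : Fin (n + 1) → Set E) : Prop where
  disjoint : ∀ i j, i ≠ j → P i ∩ P j = ∅
  iUnion_eq : ⋃ i, P i = Set.univ
  mem_iff_of_padd_eq_one : ∀ i x y, padd x y = some 1 →
    ((x ∈ P i ↔ y ∈ P i.rev) ∧ (y ∈ P i ↔ x ∈ P i.rev))
  padd_mem : ∀ i j x y s, x ∈ P i → y ∈ P j → padd x y = some s →
    ∃ k : Fin (n + 1), (k : ℕ) = i + j ∧ s ∈ P k

/-- `E` is `n`-perfect, with witnessing `n`-decomposition `P`. -/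
structure IsPerfectVia {E : Type u} [PseudoEffectAlgebra E] (n : ℕ)
    (P : Fin (n + 1) → Set E) : Prop where
  isDecomposition : IsDecomposition n P
  exists_padd : ∀ i j : Fin (n + 1), (i : ℕ) + j < n →
    ∀ x ∈ P i, ∀ y ∈ P j, ∃ s, padd x y = some s
  isMaximalIdeal : IsMaximalIdeal (P 0)
  eq_of_isMaximalIdeal : ∀ J : Set E, IsMaximalIdeal J → J = P 0

/-- Isomorphisms of pseudo effect algebras: bijections `f` with `f 1 = 1` such that
`f a + f b` exists iff `a + b` exists, in which case `f a + f b = f (a + b)`. -/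
structure Iso (E : Type u) (F : Type v) [PseudoEffectAlgebra E] [PseudoEffectAlgebra F]
    extends E ≃ F where
  map_one : toFun 1 = 1
  map_padd : ∀ a b, padd (toFun a) (toFun b) = (padd a b).map toFun

end PseudoEffectAlgebra

/-! A po-group is an additive, not necessarily commutative group with a partial order for which
left and right translations are monotone:
`[AddGroup G] [PartialOrder G] [AddLeftMono G] [AddRightMono G]`. -/

namespace POGroup

/-- The property `RDP₁` of a po-group. -/
def RDP1 (G : Type u) [AddGroup G] [PartialOrder G] : Prop :=
  ∀ a₁ a₂ b₁ b₂ : G, 0 ≤ a₁ → 0 ≤ a₂ → 0 ≤ b₁ → 0 ≤ b₂ → a₁ + a₂ = b₁ + b₂ →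
    ∃ c₁₁ c₁₂ c₂₁ c₂₂ : G, 0 ≤ c₁₁ ∧ 0 ≤ c₁₂ ∧ 0 ≤ c₂₁ ∧ 0 ≤ c₂₂ ∧
      a₁ = c₁₁ + c₁₂ ∧ a₂ = c₂₁ + c₂₂ ∧ b₁ = c₁₁ + c₂₁ ∧ b₂ = c₁₂ + c₂₂ ∧
      ∀ x y : G, 0 ≤ x → x ≤ c₁₂ → 0 ≤ y → y ≤ c₂₁ → x + y = y + x

/-- No nonzero element has finite order. (For noncommutative groups `IsAddTorsionFree` is the
stronger property of unique extraction of roots.) -/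
def TorsionFree (G : Type u) [AddGroup G] : Prop :=
  ∀ g : G, g ≠ 0 → ∀ k : ℤ, k ≠ 0 → k • g ≠ 0

/-- Strong (order) units. -/
structure IsStrongUnit {G : Type u} [AddGroup G] [PartialOrder G] (e : G) : Prop where
  nonneg : 0 ≤ e
  exists_le_nsmul : ∀ g : G, ∃ k : ℕ, 1 ≤ k ∧ g ≤ k • e

/-- The interval `Γ(G, e) = {g ∈ G : 0 ≤ g ≤ e}`. -/
@[ext] structure Gamma {G : Type u} [AddGroup G] [PartialOrder G] (e : G) (he : 0 ≤ e) :
    Type u where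
  /-- the underlying group element -/
  val : G
  nonneg : 0 ≤ val
  le : val ≤ e

open Classical in
/-- The restriction of the group addition to `Γ(G, e)`. -/
noncomputable def Gamma.padd {G : Type u} [AddGroup G] [PartialOrder G] {e : G} {he : 0 ≤ e}
    (a b : Gamma e he) : Option (Gamma e he) :=
  if h : 0 ≤ a.1 + b.1 ∧ a.1 + b.1 ≤ e then some ⟨a.1 + b.1, h.1, h.2⟩ else none

theorem Gamma.padd_eq_some {G : Type u} [AddGroup G] [PartialOrder G] {e : G} {he : 0 ≤ e}
    {a b c : Gamma e he} : Gamma.padd a b = some c ↔ a.1 + b.1 = c.1 := by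
  unfold Gamma.padd
  split_ifs with h
  · rw [Option.some_inj]
    exact Gamma.ext_iff
  · simp only [false_iff]
    intro hc
    exact h (hc ▸ ⟨c.nonneg, c.le⟩)

noncomputable instance Gamma.instPseudoEffectAlgebra {G : Type u} [AddGroup G] [PartialOrder G] [AddLeftMono G]
    [AddRightMono G] (e : G) (he : 0 ≤ e) : PseudoEffectAlgebra (Gamma e he) where
  zero := ⟨0, le_rfl, he⟩
  one := ⟨e, he, le_rfl⟩
  padd := Gamma.padd
  padd_assoc a b c := by
    ext s
    simp only [Option.bind_eq_some_iff, Gamma.padd_eq_some]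
    constructor
    · rintro ⟨t, h1, h2⟩
      have h3 : a.1 + (b.1 + c.1) = s.1 := by rw [← add_assoc, h1, h2]
      refine ⟨⟨b.1 + c.1, add_nonneg b.nonneg c.nonneg, ?_⟩, rfl, h3⟩
      calc b.1 + c.1 ≤ a.1 + (b.1 + c.1) := le_add_of_nonneg_left a.nonneg
        _ = s.1 := h3
        _ ≤ e := s.le
    · rintro ⟨t, h1, h2⟩
      have h3 : a.1 + b.1 + c.1 = s.1 := by rw [add_assoc, h1, h2]
      refine ⟨⟨a.1 + b.1, add_nonneg a.nonneg b.nonneg, ?_⟩, rfl, h3⟩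
      calc a.1 + b.1 ≤ a.1 + b.1 + c.1 := le_add_of_nonneg_right c.nonneg
        _ = s.1 := h3
        _ ≤ e := s.le
  existsUnique_right a := by
    refine ⟨⟨-a.1 + e, ?_, ?_⟩, ?_, ?_⟩
    · rw [le_neg_add_iff_add_le, add_zero]; exact a.le
    · exact add_le_of_nonpos_left (neg_nonpos.2 a.nonneg)
    · exact Gamma.padd_eq_some.2 (add_neg_cancel_left a.1 e)
    · intro d hd
      exact Gamma.ext (eq_neg_add_of_add_eq (Gamma.padd_eq_some.1 hd))
  existsUnique_left a := by
    refine ⟨⟨e - a.1, sub_nonneg.2 a.le, sub_le_self e a.nonneg⟩, ?_, ?_⟩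
    · exact Gamma.padd_eq_some.2 (sub_add_cancel e a.1)
    · intro d hd
      exact Gamma.ext (eq_sub_of_add_eq (Gamma.padd_eq_some.1 hd))
  padd_conj a b s h := by
    have h' := Gamma.padd_eq_some.1 h
    have ha : a.1 ≤ s.1 := by rw [← h']; exact le_add_of_nonneg_right b.nonneg
    have hb : b.1 ≤ s.1 := by rw [← h']; exact le_add_of_nonneg_left a.nonneg
    refine ⟨⟨⟨s.1 - a.1, sub_nonneg.2 ha, (sub_le_self s.1 a.nonneg).trans s.le⟩, ?_⟩,
      ⟨⟨-b.1 + s.1, ?_, ?_⟩, ?_⟩⟩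
    · exact Gamma.padd_eq_some.2 (sub_add_cancel s.1 a.1)
    · rw [le_neg_add_iff_add_le, add_zero]; exact hb
    · exact (add_le_of_nonpos_left (neg_nonpos.2 b.nonneg)).trans s.le
    · exact Gamma.padd_eq_some.2 (add_neg_cancel_left b.1 s.1)
  eq_zero_of_padd_one a h := by
    refine Gamma.ext (le_antisymm ?_ a.nonneg)
    rcases h with h | h
    · obtain ⟨s, hs⟩ := Option.isSome_iff_exists.1 h
      have h1 : a.1 + e = s.1 := Gamma.padd_eq_some.1 hs
      have h2 : a.1 + e ≤ e := h1 ▸ s.le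
      exact add_le_iff_nonpos_left.1 h2
    · obtain ⟨s, hs⟩ := Option.isSome_iff_exists.1 h
      have h1 : e + a.1 = s.1 := Gamma.padd_eq_some.1 hs
      have h2 : e + a.1 ≤ e := h1 ▸ s.le
      exact (add_le_iff_nonpos_right _).1 h2

/-- The lexicographic product `ℤ ×ₗ G` is a po-group. -/
instance lexAddLeftMono (G : Type u) [AddGroup G] [PartialOrder G] [AddLeftMono G] :
    AddLeftMono (ℤ ×ₗ G) where
  elim a b c h := by
    refine Prod.Lex.le_iff.2 ?_
    rcases Prod.Lex.le_iff.1 h with h | ⟨h, h'⟩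
    · exact Or.inl (add_lt_add_right h _)
    · exact Or.inr ⟨congrArg (fun t => (ofLex a).1 + t) h, add_le_add_right h' _⟩

instance lexAddRightMono (G : Type u) [AddGroup G] [PartialOrder G] [AddRightMono G] :
    AddRightMono (ℤ ×ₗ G) where
  elim a b c h := by
    refine Prod.Lex.le_iff.2 ?_
    rcases Prod.Lex.le_iff.1 h with h | ⟨h, h'⟩
    · exact Or.inl (add_lt_add_left h _)
    · exact Or.inr ⟨congrArg (fun t => t + (ofLex a).1) h, add_le_add_left h' _⟩

theorem lex_nonneg (G : Type u) [AddGroup G] [PartialOrder G] (n : ℕ) :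
    (0 : ℤ ×ₗ G) ≤ toLex ((n : ℤ), (0 : G)) := by
  rw [Prod.Lex.le_iff]
  rcases Nat.eq_zero_or_pos n with rfl | h
  · exact Or.inr ⟨rfl, le_rfl⟩
  · exact Or.inl (Int.natCast_pos.2 h)

/-- The interval `Γ(ℤ ×ₗ G, (n, 0))` of the lexicographic product, with the pseudo effect algebra structure of an interval. -/
abbrev LexGamma (n : ℕ) (G : Type u) [AddGroup G] [PartialOrder G] : Type u :=
  Gamma (toLex ((n : ℤ), (0 : G))) (lex_nonneg G n)

end POGroup

/-- `E` is a strong `n`-perfect pseudo effect algebra: it is `n`-perfect, has `RDP₁`, and is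
represented as `Γ(H, e)` for a torsion-free unital po-group `(H, e)` in such a way that some
`c ∈ E₁` satisfies `n c = e` and is central in `H`. -/
def PseudoEffectAlgebra.IsStrongPerfect (n : ℕ) (E : Type u) [PseudoEffectAlgebra E] : Prop :=
  ∃ P : Fin (n + 1) → Set E, PseudoEffectAlgebra.IsPerfectVia n P ∧
    PseudoEffectAlgebra.RDP1 E ∧
    ∃ (H : Type u) (_ : AddGroup H) (_ : PartialOrder H) (_ : AddLeftMono H) (_ : AddRightMono H)
      (e : H) (he : POGroup.IsStrongUnit e)
      (φ : PseudoEffectAlgebra.Iso E (POGroup.Gamma e he.nonneg)),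
      POGroup.TorsionFree H ∧
      ∃ c ∈ P 1, n • (φ.toFun c).1 = e ∧ ∀ x : H, (φ.toFun c).1 + x = x + (φ.toFun c).1

set_option linter.unusedSectionVars false

open PseudoEffectAlgebra POGroup

/-! If `E` is the interval `[0, (n, 0)]` of `ℤ ×ₗ G`, the first coordinate cuts it into slices. A
proper ideal cannot leave slice `0` (`subset_slice_zero`), so that slice is the only maximal ideal.
`lex_rdp1` lifts `RDP₁` from the directed group `G`, and `(1, 0)` is the required central element.

Conversely, let `E` be `[0, e]` in `H`, with `c` central in the first slice and `n c = e`. The slice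
of index `0` is a downward closed set of positive elements, closed under addition; its differences
form a directed subgroup `G` of `H` whose positive cone is exactly that slice. By `RDP₁`, an element
`x` of slice `i` satisfies `x - i c ∈ G` (`sub_nsmul_mem_of_le`). Centrality of `c` makes `x ↦ (i, x
- i c)` additive, and it identifies `E` with the lexicographic interval
(`exists_isIntervalRep_lex`).

For uniqueness, the cone of `G` is the unique maximal ideal of `E` with its addition, and a directed
po-group is determined by its cone (`nonempty_orderAddMonoidIso_of_cone`). -/

/-- `v` identifies the pseudo effect algebra `E` with the interval `[0, e]` of the po-group `H`. -/
structure IsIntervalRep {E : Type u} [PseudoEffectAlgebra E] {H : Type v} [AddGroup H]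
    [PartialOrder H] (e : H) (f : E → H) : Prop where
  injective : Function.Injective f
  nonneg : ∀ x, 0 ≤ f x
  le : ∀ x, f x ≤ e
  exists_eq : ∀ h, 0 ≤ h → h ≤ e → ∃ x, f x = h
  padd_iff : ∀ a b s, padd a b = some s ↔ f a + f b = f s
  map_one : f 1 = e

/-! ### Representations as intervals of po-groups -/

namespace IsIntervalRep

section
variable {E : Type u} [PseudoEffectAlgebra E] {H : Type v} [AddGroup H] [PartialOrder H]
  [AddLeftMono H] [AddRightMono H] {e : H} {f : E → H}

theorem of_iso {he : 0 ≤ e} (φ : Iso E (Gamma e he)) :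
    IsIntervalRep e fun x => (φ.toFun x).val where
  injective x y h := φ.toEquiv.injective (Gamma.ext h)
  nonneg x := (φ.toFun x).nonneg
  le x := (φ.toFun x).le
  exists_eq h h0 h1 := by
    obtain ⟨x, hx⟩ := φ.toEquiv.surjective ⟨h, h0, h1⟩
    exact ⟨x, congrArg Gamma.val hx⟩
  padd_iff a b s := by
    have h : padd (φ.toFun a) (φ.toFun b) = some (φ.toFun s) ↔ _ := Gamma.padd_eq_some
    rw [← h, φ.map_padd]
    constructor
    · intro h; rw [h]; rfl
    · intro h
      obtain ⟨t, ht, hts⟩ := Option.map_eq_some_iff.1 h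
      rw [ht, φ.toEquiv.injective hts]
  map_one := congrArg Gamma.val φ.map_one

theorem nonempty_iso (hf : IsIntervalRep e f) (he : 0 ≤ e) : Nonempty (Iso E (Gamma e he)) := by
  let g : E → Gamma e he := fun x => ⟨f x, hf.nonneg x, hf.le x⟩
  have hg : Function.Bijective g := by
    refine ⟨fun x y h => hf.injective (congrArg Gamma.val h), fun y => ?_⟩
    obtain ⟨x, hx⟩ := hf.exists_eq y.val y.nonneg y.le
    exact ⟨x, Gamma.ext hx⟩
  refine ⟨⟨Equiv.ofBijective g hg, Gamma.ext hf.map_one, fun a b => ?_⟩⟩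
  change padd (g a) (g b) = (padd a b).map g
  have key : ∀ s, padd (g a) (g b) = some (g s) ↔ padd a b = some s := fun s =>
    Iff.trans Gamma.padd_eq_some (hf.padd_iff a b s).symm
  ext t
  obtain ⟨s, rfl⟩ := hg.surjective t
  rw [key, Option.map_eq_some_iff]
  constructor
  · intro h; exact ⟨s, h, rfl⟩
  · rintro ⟨s', h, hs⟩
    rw [h, hg.injective hs]

theorem le_iff (hf : IsIntervalRep e f) {a b : E} : Le a b ↔ f a ≤ f b := by
  constructor
  · rintro ⟨c, hc⟩
    rw [← (hf.padd_iff a c b).1 hc]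
    exact le_add_of_nonneg_right (hf.nonneg c)
  · intro h
    obtain ⟨c, hc⟩ := hf.exists_eq (-f a + f b) (by rwa [le_neg_add_iff_add_le, add_zero])
      ((add_le_of_nonpos_left (neg_nonpos.2 (hf.nonneg a))).trans (hf.le b))
    exact ⟨c, (hf.padd_iff _ _ _).2 (by rw [hc, add_neg_cancel_left])⟩

theorem exists_padd (hf : IsIntervalRep e f) {a b : E} (h : f a + f b ≤ e) :
    ∃ s, padd a b = some s ∧ f s = f a + f b := by
  obtain ⟨s, hs⟩ := hf.exists_eq _ (add_nonneg (hf.nonneg a) (hf.nonneg b)) h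
  exact ⟨s, (hf.padd_iff _ _ _).2 hs.symm, hs⟩

theorem padd_comm (hf : IsIntervalRep e f) {a b : E} (h : f a + f b = f b + f a) :
    padd a b = padd b a := by
  ext s
  rw [hf.padd_iff, hf.padd_iff, h]

/-- Each entry of a refinement in `H` lies below `f a₁` or `f a₂`, so it already belongs to the
interval. -/
theorem rdp1 (hf : IsIntervalRep e f) (hH : POGroup.RDP1 H) : PseudoEffectAlgebra.RDP1 E := by
  intro a₁ a₂ b₁ b₂ s ha hb
  rw [hf.padd_iff] at ha hb
  obtain ⟨c₁₁, c₁₂, c₂₁, c₂₂, h11, h12, h21, h22, ha1, ha2, hb1, hb2, hc⟩ :=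
    hH (f a₁) (f a₂) (f b₁) (f b₂) (hf.nonneg _) (hf.nonneg _) (hf.nonneg _) (hf.nonneg _)
      (ha.trans hb.symm)
  obtain ⟨d₁₁, rfl⟩ := hf.exists_eq c₁₁ h11
    ((le_add_of_nonneg_right h12).trans (ha1 ▸ hf.le a₁))
  obtain ⟨d₁₂, rfl⟩ := hf.exists_eq c₁₂ h12
    ((le_add_of_nonneg_left h11).trans (ha1 ▸ hf.le a₁))
  obtain ⟨d₂₁, rfl⟩ := hf.exists_eq c₂₁ h21
    ((le_add_of_nonneg_right h22).trans (ha2 ▸ hf.le a₂))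
  obtain ⟨d₂₂, rfl⟩ := hf.exists_eq c₂₂ h22
    ((le_add_of_nonneg_left h21).trans (ha2 ▸ hf.le a₂))
  refine ⟨d₁₁, d₁₂, d₂₁, d₂₂, (hf.padd_iff _ _ _).2 ha1.symm, (hf.padd_iff _ _ _).2 ha2.symm,
    (hf.padd_iff _ _ _).2 hb1.symm, (hf.padd_iff _ _ _).2 hb2.symm, fun x y hx hy => ?_⟩
  exact hf.padd_comm (hc _ _ (hf.nonneg x) (hf.le_iff.1 hx) (hf.nonneg y) (hf.le_iff.1 hy))

end

end IsIntervalRep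

/-! ### Lexicographic products with `ℤ` -/

section Lex

variable {G : Type v} [AddGroup G] [PartialOrder G]

theorem TorsionFree.lex (hG : POGroup.TorsionFree G) : POGroup.TorsionFree (ℤ ×ₗ G) := by
  intro g hg k hk h
  have h1 : k • (ofLex g).1 = 0 := congrArg (fun t => (ofLex t).1) h
  have h2 : k • (ofLex g).2 = 0 := congrArg (fun t => (ofLex t).2) h
  have h1' : (ofLex g).1 = 0 := (smul_eq_zero.1 h1).resolve_left hk
  have h2' : (ofLex g).2 = 0 := by
    by_contra h3
    exact hG _ h3 k hk h2
  exact hg (ofLex.injective (Prod.ext h1' h2'))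

theorem isStrongUnit_lex {n : ℕ} (hn : 1 ≤ n) :
    IsStrongUnit (toLex ((n : ℤ), (0 : G))) where
  nonneg := lex_nonneg G n
  exists_le_nsmul g := by
    -- The `+ 1` makes the first coordinate of the multiple strictly larger, so second coordinates
    -- play no role.
    refine ⟨(ofLex g).1.toNat + 1, by omega, Prod.Lex.le_iff.2 (Or.inl ?_)⟩
    change (ofLex g).1 < ((ofLex g).1.toNat + 1) • (n : ℤ)
    rw [nsmul_eq_mul]
    have h1 : (ofLex g).1 ≤ (ofLex g).1.toNat := Int.self_le_toNat _
    have h2 : (1 : ℤ) ≤ n := by exact_mod_cast hn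
    push_cast
    nlinarith [Int.natCast_nonneg (ofLex g).1.toNat]

theorem lex_nonneg_cases {x : ℤ ×ₗ G} (h : 0 ≤ x) :
    0 < (ofLex x).1 ∨ 0 = (ofLex x).1 ∧ 0 ≤ (ofLex x).2 :=
  Prod.Lex.le_iff.1 h

variable [AddLeftMono G] [AddRightMono G]

theorem exists_common_lower [IsDirectedOrder G] (a b : G) : ∃ k, k ≤ a ∧ k ≤ b := by
  obtain ⟨k, h1, h2⟩ := exists_ge_ge (-a) (-b)
  exact ⟨-k, neg_le.1 h1, neg_le.1 h2⟩

/-- A strict inequality of first coordinates makes `-b₁ + a₁` positive whatever its second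
coordinate. One off-diagonal entry of the refinement can then be `0`, and its commutation condition
is trivial. -/
theorem lex_rdp1_of_lt (a₁ a₂ b₁ b₂ : ℤ ×ₗ G)
    (h : a₁ + a₂ = b₁ + b₂) (hlt : (ofLex b₁).1 < (ofLex a₁).1) :
    ∃ c₁₂ : ℤ ×ₗ G, 0 ≤ c₁₂ ∧ a₁ = b₁ + c₁₂ ∧ b₂ = c₁₂ + a₂ := by
  refine ⟨-b₁ + a₁, ?_, (add_neg_cancel_left _ _).symm, ?_⟩
  · rw [le_neg_add_iff_add_le, add_zero]
    exact Prod.Lex.le_iff.2 (Or.inl hlt)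
  · rw [add_assoc, h, neg_add_cancel_left]

/-- If `G` is directed and has `RDP₁`, then so does the lexicographic product `ℤ ×ₗ G`. -/
theorem lex_rdp1 [IsDirectedOrder G] (hG : POGroup.RDP1 G) : POGroup.RDP1 (ℤ ×ₗ G) := by
  intro a₁ a₂ b₁ b₂ ha1 ha2 hb1 hb2 h
  have hfst : (ofLex a₁).1 + (ofLex a₂).1 = (ofLex b₁).1 + (ofLex b₂).1 :=
    congrArg (fun t => (ofLex t).1) h
  have hsnd : (ofLex a₁).2 + (ofLex a₂).2 = (ofLex b₁).2 + (ofLex b₂).2 :=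
    congrArg (fun t => (ofLex t).2) h
  rcases lt_trichotomy (ofLex b₁).1 (ofLex a₁).1 with hlt | heq | hlt
  · obtain ⟨c, hc, h1, h2⟩ := lex_rdp1_of_lt a₁ a₂ b₁ b₂ h hlt
    refine ⟨b₁, c, 0, a₂, hb1, hc, le_rfl, ha2, h1, (zero_add _).symm, (add_zero _).symm, h2, ?_⟩
    intro x y _ _ hy hy'
    rw [le_antisymm hy' hy, add_zero, zero_add]
  · have heq2 : (ofLex b₂).1 = (ofLex a₂).1 := by omega
    -- At a positive level the second coordinates may be negative; a common lower bound shifts them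
    -- into the cone. At level `0` they are already positive, and the shift must be `0` to keep the
    -- shifted-back entry positive.
    have lower : ∀ a b : ℤ ×ₗ G, 0 ≤ a → 0 ≤ b → (ofLex b).1 = (ofLex a).1 →
        ∃ k, k ≤ (ofLex a).2 ∧ k ≤ (ofLex b).2 ∧ (0 < (ofLex a).1 ∨ 0 = (ofLex a).1 ∧ k = 0) := by
      intro a b ha hb hab
      rcases lex_nonneg_cases ha with h0 | ⟨h0, h1⟩
      · obtain ⟨k, hk, hk'⟩ := exists_common_lower (ofLex a).2 (ofLex b).2
        exact ⟨k, hk, hk', Or.inl h0⟩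
      · rcases lex_nonneg_cases hb with h2 | ⟨_, h2⟩
        · omega
        · exact ⟨0, h1, h2, Or.inr ⟨h0, rfl⟩⟩
    obtain ⟨k, hka, hkb, hk⟩ := lower a₁ b₁ ha1 hb1 heq
    obtain ⟨l, hla, hlb, hl⟩ := lower a₂ b₂ ha2 hb2 heq2
    -- Shifting by `k` at the far left and by `l` at the far right preserves the equality of sums
    -- without commutativity. The shifts are later returned to the diagonal entries only, so the
    -- off-diagonal entries stay at level `0`, where `G` supplies commutation.
    obtain ⟨c₁₁, c₁₂, c₂₁, c₂₂, h11, h12, h21, h22, e1, e2, e3, e4, hc⟩ :=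
      hG (-k + (ofLex a₁).2) ((ofLex a₂).2 - l) (-k + (ofLex b₁).2) ((ofLex b₂).2 - l)
        (by rwa [le_neg_add_iff_add_le, add_zero]) (sub_nonneg.2 hla)
        (by rwa [le_neg_add_iff_add_le, add_zero]) (sub_nonneg.2 hlb)
        (by
          rw [sub_eq_add_neg, sub_eq_add_neg, add_assoc, ← add_assoc (ofLex a₁).2, hsnd]
          simp only [add_assoc])
    have hzero : ∀ x : ℤ ×ₗ G, ∀ c : G, 0 ≤ x → x ≤ toLex (0, c) →
        ∃ y, x = toLex (0, y) ∧ 0 ≤ y ∧ y ≤ c := by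
      intro x c hx hxc
      rcases lex_nonneg_cases hx with h1 | ⟨h1, h1'⟩ <;>
      rcases Prod.Lex.le_iff.1 hxc with h2 | ⟨h2, h2'⟩
      · exact absurd (h1.trans h2) (lt_irrefl _)
      · exact absurd h2 h1.ne'
      · exact absurd h1 h2.ne'
      · exact ⟨(ofLex x).2, ofLex.injective (Prod.ext h1.symm rfl), h1', h2'⟩
    refine ⟨toLex ((ofLex a₁).1, k + c₁₁), toLex (0, c₁₂), toLex (0, c₂₁),
      toLex ((ofLex a₂).1, c₂₂ + l), ?_, ?_, ?_, ?_, ?_, ?_, ?_, ?_, ?_⟩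
    · refine Prod.Lex.le_iff.2 ?_
      rcases hk with hk | ⟨hk, rfl⟩
      · exact Or.inl hk
      · exact Or.inr ⟨hk, by simpa using h11⟩
    · exact Prod.Lex.le_iff.2 (Or.inr ⟨rfl, h12⟩)
    · exact Prod.Lex.le_iff.2 (Or.inr ⟨rfl, h21⟩)
    · refine Prod.Lex.le_iff.2 ?_
      rcases hl with hl | ⟨hl, rfl⟩
      · exact Or.inl hl
      · exact Or.inr ⟨hl, by simpa using h22⟩
    · refine ofLex.injective (Prod.ext (add_zero _).symm ?_)
      change (ofLex a₁).2 = k + c₁₁ + c₁₂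
      rw [add_assoc, ← e1, add_neg_cancel_left]
    · refine ofLex.injective (Prod.ext (zero_add _).symm ?_)
      change (ofLex a₂).2 = c₂₁ + (c₂₂ + l)
      rw [← add_assoc, ← e2, sub_add_cancel]
    · refine ofLex.injective (Prod.ext (heq.trans (add_zero _).symm) ?_)
      change (ofLex b₁).2 = k + c₁₁ + c₂₁
      rw [add_assoc, ← e3, add_neg_cancel_left]
    · refine ofLex.injective (Prod.ext (heq2.trans (zero_add _).symm) ?_)
      change (ofLex b₂).2 = c₁₂ + (c₂₂ + l)
      rw [← add_assoc, ← e4, sub_add_cancel]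
    · intro x y hx hx' hy hy'
      obtain ⟨x, rfl, hx0, hxc⟩ := hzero x _ hx hx'
      obtain ⟨y, rfl, hy0, hyc⟩ := hzero y _ hy hy'
      exact ofLex.injective (Prod.ext rfl (hc x y hx0 hxc hy0 hyc))
  · obtain ⟨c, hc, h1, h2⟩ := lex_rdp1_of_lt b₁ b₂ a₁ a₂ h.symm hlt
    refine ⟨a₁, 0, c, b₂, ha1, le_rfl, hc, hb2, (add_zero _).symm, h2, h1, (zero_add _).symm, ?_⟩
    intro x y hx hx' _ _
    rw [le_antisymm hx' hx, add_zero, zero_add]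

end Lex

/-! ### Slices and ideals of the lexicographic interval -/

namespace IsIntervalRep

section
variable {E : Type u} [PseudoEffectAlgebra E] {G : Type v} [AddGroup G] [PartialOrder G]
  [AddLeftMono G] [AddRightMono G] {n : ℕ} {f : E → ℤ ×ₗ G}

/-- The elements whose first coordinate in the lexicographic product is `i`. -/
def slice (f : E → ℤ ×ₗ G) (i : Fin (n + 1)) : Set E :=
  {x | (ofLex (f x)).1 = (i : ℕ)}

theorem fst_nonneg (hf : IsIntervalRep (toLex ((n : ℤ), (0 : G))) f) (x : E) :
    0 ≤ (ofLex (f x)).1 := by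
  rcases lex_nonneg_cases (hf.nonneg x) with h | ⟨h, _⟩ <;> omega

theorem fst_le (hf : IsIntervalRep (toLex ((n : ℤ), (0 : G))) f) (x : E) :
    (ofLex (f x)).1 ≤ n := by
  rcases Prod.Lex.le_iff.1 (hf.le x) with h | ⟨h, _⟩
  · exact h.le
  · exact h.le

theorem isDecomposition_slice (hf : IsIntervalRep (toLex ((n : ℤ), (0 : G))) f) :
    IsDecomposition n (slice (n := n) f) where
  disjoint i j hij := by
    ext x
    simp only [slice, Set.mem_inter_iff, Set.mem_ofPred_eq, Set.mem_empty_iff_false, iff_false]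
    rintro ⟨h1, h2⟩
    exact hij (Fin.ext (by omega))
  iUnion_eq := by
    refine Set.eq_univ_of_forall fun x => Set.mem_iUnion.2 ?_
    have h0 := hf.fst_nonneg x
    have h1 := hf.fst_le x
    refine ⟨⟨(ofLex (f x)).1.toNat, by omega⟩, ?_⟩
    change (ofLex (f x)).1 = ((ofLex (f x)).1.toNat : ℤ)
    omega
  mem_iff_of_padd_eq_one i x y h := by
    rw [hf.padd_iff, hf.map_one] at h
    have h1 : (ofLex (f x)).1 + (ofLex (f y)).1 = n := congrArg (fun t => (ofLex t).1) h
    have h2 : (i.rev : ℕ) = n - i := by rw [Fin.val_rev]; omega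
    have h3 := i.2
    simp only [slice, Set.mem_ofPred_eq, h2]
    constructor <;> constructor <;> intro h <;> omega
  padd_mem i j x y s hx hy h := by
    rw [hf.padd_iff] at h
    have h1 : (ofLex (f x)).1 + (ofLex (f y)).1 = (ofLex (f s)).1 :=
      congrArg (fun t => (ofLex t).1) h
    have h2 := hf.fst_le s
    simp only [slice, Set.mem_ofPred_eq] at hx hy
    refine ⟨⟨i + j, by omega⟩, rfl, ?_⟩
    change (ofLex (f s)).1 = ((i + j : ℕ) : ℤ)
    omega

theorem isIdeal_slice_zero (hf : IsIntervalRep (toLex ((n : ℤ), (0 : G))) f) :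
    IsIdeal (slice (n := n) f 0) where
  nonempty := by
    obtain ⟨x, hx⟩ := hf.exists_eq 0 le_rfl (lex_nonneg G n)
    refine ⟨x, ?_⟩
    change (ofLex (f x)).1 = ((0 : ℕ) : ℤ)
    rw [hx]; rfl
  padd_mem a ha b hb s h := by
    rw [hf.padd_iff] at h
    have h1 : (ofLex (f a)).1 + (ofLex (f b)).1 = (ofLex (f s)).1 :=
      congrArg (fun t => (ofLex t).1) h
    simp only [slice, Set.mem_ofPred_eq] at ha hb ⊢
    rw [← h1, ha, hb]; simp
  mem_of_le a b hab hb := by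
    have h0 := hf.fst_nonneg a
    simp only [slice, Set.mem_ofPred_eq, Fin.val_zero, Nat.cast_zero] at hb ⊢
    rcases Prod.Lex.le_iff.1 (hf.le_iff.1 hab) with h | ⟨h, _⟩ <;> omega

/-- The sign of `h` matters only at `k = n`, where `(n, n h)` must still lie below `(n, 0)`. -/
theorem exists_nsmul_mem_ideal (hf : IsIntervalRep (toLex ((n : ℤ), (0 : G))) f) {J : Set E}
    (hJ : IsIdeal J) {h : G} (h0 : h ≤ 0) {x : E} (hx : x ∈ J) (hfx : f x = toLex (1, h)) :
    ∀ k : ℕ, 1 ≤ k → k ≤ n → ∃ y ∈ J, f y = toLex ((k : ℤ), k • h) := by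
  intro k hk
  induction k, hk using Nat.le_induction with
  | base => exact fun _ => ⟨x, hx, by simpa using hfx⟩
  | succ k hk ih =>
    intro hkn
    obtain ⟨y, hy, hfy⟩ := ih (by omega)
    have hsum : f y + f x = toLex (((k + 1 : ℕ) : ℤ), (k + 1) • h) := by
      rw [hfx, hfy, succ_nsmul]
      refine ofLex.injective (Prod.ext ?_ rfl)
      change (k : ℤ) + 1 = ((k + 1 : ℕ) : ℤ)
      push_cast; rfl
    obtain ⟨s, hs, hfs⟩ := hf.exists_padd (a := y) (b := x) (by
      rw [hsum]
      refine Prod.Lex.le_iff.2 ?_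
      rcases hkn.lt_or_eq with hlt | heq
      · exact Or.inl (Int.ofNat_lt.2 hlt)
      · exact Or.inr ⟨congrArg Nat.cast heq, nsmul_nonpos h0 _⟩)
    exact ⟨s, hJ.padd_mem _ hy _ hx _ hs, hfs.trans hsum⟩

/-- An ideal leaving slice `0` contains some `(1, h)` with `h ≤ 0`, hence `(n, n h)`. It also
contains `(0, -n h)`, which lies below `(1, h)`. These add up to the unit. -/
theorem subset_slice_zero (hf : IsIntervalRep (toLex ((n : ℤ), (0 : G))) f) (hn : 1 ≤ n)
    [IsDirectedOrder G] {J : Set E} (hJ : IsIdeal J) (hne : J ≠ Set.univ) :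
    J ⊆ slice (n := n) f 0 := by
  intro x hx
  by_contra hx0
  refine hne (Set.eq_univ_of_forall fun z => ?_)
  have hpos : 0 < (ofLex (f x)).1 := lt_of_le_of_ne (hf.fst_nonneg x) (Ne.symm hx0)
  obtain ⟨h, hh, hh0⟩ := exists_common_lower (ofLex (f x)).2 0
  have hle : toLex ((1 : ℤ), h) ≤ f x := by
    refine Prod.Lex.le_iff.2 ?_
    rcases (Int.add_one_le_iff.2 hpos).lt_or_eq with hlt | heq
    · exact Or.inl hlt
    · exact Or.inr ⟨heq, hh⟩
  obtain ⟨y, hy⟩ := hf.exists_eq _ (Prod.Lex.le_iff.2 (Or.inl zero_lt_one)) (hle.trans (hf.le x))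
  have hyJ : y ∈ J := hJ.mem_of_le _ _ (hf.le_iff.2 (hy ▸ hle)) hx
  obtain ⟨s, hsJ, hs⟩ := hf.exists_nsmul_mem_ideal hJ hh0 hyJ hy n hn le_rfl
  have hle' : toLex ((0 : ℤ), -(n • h)) ≤ f y := by
    rw [hy]; exact Prod.Lex.le_iff.2 (Or.inl zero_lt_one)
  obtain ⟨t, ht⟩ := hf.exists_eq (toLex ((0 : ℤ), -(n • h)))
    (Prod.Lex.le_iff.2 (Or.inr ⟨rfl, neg_nonneg.2 (nsmul_nonpos hh0 n)⟩)) (hle'.trans (hf.le y))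
  have htJ : t ∈ J := hJ.mem_of_le _ _ (hf.le_iff.2 (ht ▸ hle')) hyJ
  have hsum : padd s t = some 1 := by
    rw [hf.padd_iff, hf.map_one, hs, ht]
    exact ofLex.injective (Prod.ext (add_zero _) (add_neg_cancel (n • h)))
  refine hJ.mem_of_le z 1 ?_ (hJ.padd_mem _ hsJ _ htJ _ hsum)
  rw [hf.le_iff, hf.map_one]
  exact hf.le z

theorem isPerfectVia_slice (hf : IsIntervalRep (toLex ((n : ℤ), (0 : G))) f) (hn : 1 ≤ n)
    [IsDirectedOrder G] : IsPerfectVia n (slice (n := n) f) := by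
  have hmax : IsMaximalIdeal (slice (n := n) f 0) := by
    refine ⟨hf.isIdeal_slice_zero, fun h => ?_, fun J hJ hne hsub =>
      (hf.subset_slice_zero hn hJ hne).antisymm hsub⟩
    have h1 : (ofLex (f 1)).1 = ((0 : ℕ) : ℤ) := Set.eq_univ_iff_forall.1 h 1
    rw [hf.map_one] at h1
    have h2 : (n : ℤ) = ((0 : ℕ) : ℤ) := h1
    omega
  refine ⟨hf.isDecomposition_slice, fun i j hij x hx y hy => ?_, hmax, fun J hJ => ?_⟩
  · obtain ⟨s, hs, _⟩ := hf.exists_padd (a := x) (b := y) (by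
      refine Prod.Lex.le_iff.2 (Or.inl ?_)
      change (ofLex (f x)).1 + (ofLex (f y)).1 < (n : ℤ)
      simp only [slice, Set.mem_ofPred_eq] at hx hy
      omega)
    exact ⟨s, hs⟩
  · exact (hJ.eq_of_subset _ hmax.isIdeal hmax.ne_univ
      (hf.subset_slice_zero hn hJ.isIdeal hJ.ne_univ)).symm

end

end IsIntervalRep

theorem isStrongPerfect_of_lexGamma {E : Type u} [PseudoEffectAlgebra E] {n : ℕ} (hn : 1 ≤ n)
    {G : Type u} [AddGroup G] [PartialOrder G] [AddLeftMono G] [AddRightMono G]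
    (htf : POGroup.TorsionFree G) [IsDirectedOrder G] (hG : POGroup.RDP1 G)
    (φ : Iso E (LexGamma n G)) : IsStrongPerfect n E := by
  have hf := IsIntervalRep.of_iso φ
  refine ⟨_, hf.isPerfectVia_slice hn, hf.rdp1 (lex_rdp1 hG), ℤ ×ₗ G, inferInstance,
    inferInstance, inferInstance, inferInstance, _, isStrongUnit_lex hn, φ, TorsionFree.lex htf, ?_⟩
  obtain ⟨c, hc⟩ := hf.exists_eq (toLex ((1 : ℤ), (0 : G)))
    (Prod.Lex.le_iff.2 (Or.inl zero_lt_one)) (by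
      refine Prod.Lex.le_iff.2 ?_
      rcases hn.lt_or_eq with h | h
      · exact Or.inl (Int.ofNat_lt.2 h)
      · exact Or.inr ⟨congrArg Nat.cast h, le_rfl⟩)
  have hc' : (φ.toFun c).1 = toLex ((1 : ℤ), (0 : G)) := hc
  refine ⟨c, ?_, ?_, fun x => ?_⟩
  · change (ofLex (φ.toFun c).1).1 = (((1 : Fin (n + 1)) : ℕ) : ℤ)
    -- The numeral `1` in `Fin (n + 1)` has value `1` only because `n ≥ 1`.
    obtain ⟨m, rfl⟩ := Nat.exists_eq_add_of_le' hn
    rw [hc']; rfl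
  · rw [hc']
    refine ofLex.injective (Prod.ext ?_ (nsmul_zero n))
    change n • (1 : ℤ) = n
    simp
  · rw [hc']
    refine ofLex.injective (Prod.ext (add_comm _ _) ?_)
    exact (zero_add (ofLex x).2).trans (add_zero (ofLex x).2).symm

/-! ### Recovering a directed po-group from its cone -/

section Uniqueness

variable {G : Type v} [AddGroup G] [PartialOrder G] [AddLeftMono G] [AddRightMono G]
  {G' : Type w} [AddGroup G'] [PartialOrder G'] [AddLeftMono G'] [AddRightMono G']

theorem exists_nonneg_sub_eq [IsDirectedOrder G] (g : G) :
    ∃ x y : G, 0 ≤ x ∧ 0 ≤ y ∧ g = x - y := by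
  obtain ⟨k, h0, h1⟩ := exists_ge_ge (0 : G) g
  refine ⟨k, -g + k, h0, by rwa [le_neg_add_iff_add_le, add_zero], ?_⟩
  rw [sub_eq_add_neg, neg_add_rev, neg_neg, add_neg_cancel_left]

/-- Two elements of a directed po-group become equal after adding suitable positive elements on the right. -/
theorem exists_add_eq_add [IsDirectedOrder G] (x y : G) :
    ∃ a b : G, 0 ≤ a ∧ 0 ≤ b ∧ x + a = y + b := by
  obtain ⟨w, hx, hy⟩ := exists_ge_ge x y
  exact ⟨-x + w, -y + w, by rwa [le_neg_add_iff_add_le, add_zero],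
    by rwa [le_neg_add_iff_add_le, add_zero], by rw [add_neg_cancel_left, add_neg_cancel_left]⟩

/-- An isomorphism of the positive cones of two directed po-groups extends to the groups. -/
theorem nonempty_orderAddMonoidIso_of_cone [IsDirectedOrder G] [IsDirectedOrder G'] (f : G → G')
    (hadd : ∀ x y, 0 ≤ x → 0 ≤ y → f (x + y) = f x + f y)
    (hinj : ∀ x y, 0 ≤ x → 0 ≤ y → f x = f y → x = y)
    (hnonneg : ∀ x, 0 ≤ x → 0 ≤ f x)
    (hsurj : ∀ y, 0 ≤ y → ∃ x, 0 ≤ x ∧ f x = y) : Nonempty (G ≃+o G') := by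
  have hwd : ∀ x y x' y', 0 ≤ x → 0 ≤ y → 0 ≤ x' → 0 ≤ y' → x - y = x' - y' →
      f x - f y = f x' - f y' := by
    intro x y x' y' hx hy hx' hy' h
    -- As with right fractions, the two subtrahends are first brought to a common value.
    obtain ⟨a, b, ha, hb, hab⟩ := exists_add_eq_add y y'
    have h1 : x + a = x' + b := by
      calc x + a = (x - y) + (y + a) := by rw [← add_assoc, sub_add_cancel]
        _ = x' + b := by rw [h, hab, ← add_assoc, sub_add_cancel]
    have h2 : f x + f a = f x' + f b := by rw [← hadd x a hx ha, h1, hadd x' b hx' hb]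
    have h3 : f y + f a = f y' + f b := by rw [← hadd y a hy ha, hab, hadd y' b hy' hb]
    calc f x - f y = (f x + f a) - (f y + f a) := (add_sub_add_right_eq_sub _ _ _).symm
      _ = f x' - f y' := by rw [h2, h3, add_sub_add_right_eq_sub]
  choose p q hp hq hpq using exists_nonneg_sub_eq (G := G)
  let F : G → G' := fun g => f (p g) - f (q g)
  have hF : ∀ x y, 0 ≤ x → 0 ≤ y → F (x - y) = f x - f y := fun x y hx hy =>
    hwd _ _ _ _ (hp _) (hq _) hx hy (hpq _).symm
  have hFadd : ∀ g h, F (g + h) = F g + F h := by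
    intro g h
    obtain ⟨x, y, hx, hy, rfl⟩ := exists_nonneg_sub_eq g
    obtain ⟨x', y', hx', hy', rfl⟩ := exists_nonneg_sub_eq h
    obtain ⟨a, b, ha, hb, hab⟩ := exists_add_eq_add y x'
    -- Rewriting the inner difference `-y + x'` as `a - b` turns the sum of two differences into a
    -- single one; `f` respects the same rewriting.
    have h1 : -y + x' = a - b := by
      rw [neg_add_eq_iff_eq_add, ← add_sub_assoc, hab, add_sub_cancel_right]
    have h2 : -f y + f x' = f a - f b := by
      rw [neg_add_eq_iff_eq_add, ← add_sub_assoc, ← hadd y a hy ha, hab, hadd x' b hx' hb,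
        add_sub_cancel_right]
    have h3 : x - y + (x' - y') = (x + a) - (y' + b) := by
      calc x - y + (x' - y') = x + (-y + x') - y' := by simp only [sub_eq_add_neg, add_assoc]
        _ = _ := by rw [h1]; simp only [sub_eq_add_neg, add_assoc, neg_add_rev]
    rw [h3, hF _ _ (add_nonneg hx ha) (add_nonneg hy' hb), hF _ _ hx hy, hF _ _ hx' hy',
      hadd x a hx ha, hadd y' b hy' hb]
    symm
    calc f x - f y + (f x' - f y') = f x + (-f y + f x') - f y' := by
          simp only [sub_eq_add_neg, add_assoc]
      _ = _ := by rw [h2]; simp only [sub_eq_add_neg, add_assoc, neg_add_rev]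
  have hFnonneg : ∀ g, 0 ≤ F g ↔ 0 ≤ g := by
    intro g
    obtain ⟨x, y, hx, hy, rfl⟩ := exists_nonneg_sub_eq g
    rw [hF x y hx hy]
    constructor
    · intro h
      -- Reflecting positivity needs surjectivity onto the cone: `f x - f y` is some `f t`, and
      -- injectivity gives `t + y = x`.
      obtain ⟨t, ht, hft⟩ := hsurj _ h
      have h1 : t + y = x := hinj _ _ (add_nonneg ht hy) hx (by
        rw [hadd t y ht hy, hft, sub_add_cancel])
      rw [← h1, add_sub_cancel_right]
      exact ht
    · intro h
      have h1 := hadd (x - y) y h hy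
      rw [sub_add_cancel] at h1
      rw [h1, add_sub_cancel_right]
      exact hnonneg _ h
  let Φ : G →+ G' := AddMonoidHom.mk' F hFadd
  have hΦ : ∀ g, Φ g = F g := fun _ => rfl
  have hle : ∀ a b, Φ a ≤ Φ b ↔ a ≤ b := by
    intro a b
    rw [← sub_nonneg, ← map_sub, hΦ, hFnonneg, sub_nonneg]
  have hbij : Function.Bijective Φ := by
    constructor
    · intro a b h
      exact le_antisymm ((hle a b).1 h.le) ((hle b a).1 h.ge)
    · intro g
      obtain ⟨x', y', hx', hy', rfl⟩ := exists_nonneg_sub_eq g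
      obtain ⟨x, hx, rfl⟩ := hsurj x' hx'
      obtain ⟨y, hy, rfl⟩ := hsurj y' hy'
      exact ⟨x - y, hF x y hx hy⟩
  exact ⟨⟨AddEquiv.ofBijective Φ hbij, fun {a b} => hle a b⟩⟩

/-- Both representations have the same slice `0`, the only maximal ideal of `E`. Since `n ≥ 1`, this
slice contains all `(0, g)` with `g ≥ 0`, so it carries the whole cone of each group. -/
theorem nonempty_orderAddMonoidIso_of_lexGamma {E : Type u} [PseudoEffectAlgebra E] {n : ℕ}
    (hn : 1 ≤ n) [IsDirectedOrder G] [IsDirectedOrder G']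
    (φ : Iso E (LexGamma n G)) (ψ : Iso E (LexGamma n G')) : Nonempty (G ≃+o G') := by
  obtain ⟨f, hf⟩ : ∃ f : E → ℤ ×ₗ G, IsIntervalRep (toLex ((n : ℤ), (0 : G))) f :=
    ⟨_, IsIntervalRep.of_iso φ⟩
  obtain ⟨f', hf'⟩ : ∃ f : E → ℤ ×ₗ G', IsIntervalRep (toLex ((n : ℤ), (0 : G'))) f :=
    ⟨_, IsIntervalRep.of_iso ψ⟩
  have hslice : IsIntervalRep.slice (n := n) f 0 = IsIntervalRep.slice (n := n) f' 0 :=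
    (hf'.isPerfectVia_slice hn).eq_of_isMaximalIdeal _ (hf.isPerfectVia_slice hn).isMaximalIdeal
  have hzero : ∀ x, (ofLex (f x)).1 = 0 ↔ (ofLex (f' x)).1 = 0 := fun x =>
    Set.ext_iff.1 hslice x
  have hn' : (0 : ℤ) < n := by exact_mod_cast hn
  have hex : ∀ g : G, ∃ x : E, 0 ≤ g → f x = toLex (0, g) := by
    intro g
    by_cases hg : 0 ≤ g
    · obtain ⟨x, hx⟩ := hf.exists_eq (toLex ((0 : ℤ), g)) (Prod.Lex.le_iff.2 (Or.inr ⟨rfl, hg⟩))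
        (Prod.Lex.le_iff.2 (Or.inl hn'))
      exact ⟨x, fun _ => hx⟩
    -- Outside the cone the value is arbitrary; only positive `g` matter.
    · exact ⟨1, fun h => absurd h hg⟩
  choose r hr using hex
  have hr' : ∀ g, 0 ≤ g → f' (r g) = toLex (0, (ofLex (f' (r g))).2) := fun g hg =>
    ofLex.injective (Prod.ext ((hzero _).1 (by rw [hr g hg]; rfl)) rfl)
  refine nonempty_orderAddMonoidIso_of_cone (fun g => (ofLex (f' (r g))).2) ?_ ?_ ?_ ?_
  · intro x y hx hy
    have h1 : f (r x) + f (r y) = f (r (x + y)) := by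
      rw [hr x hx, hr y hy, hr _ (add_nonneg hx hy)]
      rfl
    have h2 := (hf'.padd_iff _ _ _).1 ((hf.padd_iff _ _ _).2 h1)
    exact (congrArg (fun t => (ofLex t).2) h2).symm
  · intro x y hx hy h
    have h1 : f' (r x) = f' (r y) := by
      rw [hr' x hx, hr' y hy]
      exact congrArg (fun t => toLex ((0 : ℤ), t)) h
    have h2 := congrArg f (hf'.injective h1)
    rw [hr x hx, hr y hy] at h2
    exact congrArg (fun t => (ofLex t).2) h2
  · intro x hx
    rcases lex_nonneg_cases (hf'.nonneg (r x)) with h | ⟨_, h⟩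
    · rw [hr' x hx] at h
      exact absurd h (lt_irrefl _)
    · exact h
  · intro y hy
    obtain ⟨x, hx⟩ := hf'.exists_eq (toLex ((0 : ℤ), y)) (Prod.Lex.le_iff.2 (Or.inr ⟨rfl, hy⟩))
      (Prod.Lex.le_iff.2 (Or.inl hn'))
    have h0 : (ofLex (f x)).1 = 0 := (hzero x).2 (by rw [hx]; rfl)
    have hg : 0 ≤ (ofLex (f x)).2 := by
      rcases lex_nonneg_cases (hf.nonneg x) with h | ⟨_, h⟩
      · omega
      · exact h
    refine ⟨(ofLex (f x)).2, hg, ?_⟩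
    have h1 : r (ofLex (f x)).2 = x := hf.injective ((hr _ hg).trans
      (ofLex.injective (Prod.ext h0.symm rfl)))
    change (ofLex (f' (r (ofLex (f x)).2))).2 = y
    rw [h1, hx]
    rfl

end Uniqueness

/-! ### The difference group of the zero slice -/

/-- The images `A 0, …, A n` in the po-group `H` of the slices of an `n`-perfect pseudo effect
algebra that is represented as the interval `[0, e]`. -/
structure IsSlicing {H : Type v} [AddGroup H] [PartialOrder H] (n : ℕ) (e : H)
    (A : ℕ → Set H) : Prop where
  nonneg : ∀ {i x}, x ∈ A i → 0 ≤ x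
  le : ∀ {i x}, x ∈ A i → x ≤ e
  index_le : ∀ {i x}, x ∈ A i → i ≤ n
  exists_mem : ∀ x, 0 ≤ x → x ≤ e → ∃ i, x ∈ A i
  index_unique : ∀ {i j x}, x ∈ A i → x ∈ A j → i = j
  add_mem : ∀ {i j x y}, x ∈ A i → y ∈ A j → x + y ≤ e → x + y ∈ A (i + j)
  index_compl : ∀ {i j x y}, x ∈ A i → y ∈ A j → x + y = e → i + j = n
  add_le : ∀ {i j x y}, x ∈ A i → y ∈ A j → i + j < n → x + y ≤ e

theorem IsIntervalRep.isSlicing {E : Type u} [PseudoEffectAlgebra E] {H : Type v} [AddGroup H]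
    [PartialOrder H] [AddLeftMono H] [AddRightMono H] {e : H} {f : E → H}
    (hf : IsIntervalRep e f) {n : ℕ} {P : Fin (n + 1) → Set E} (hP : IsPerfectVia n P) :
    IsSlicing n e fun k => {h | ∃ x, ∃ i : Fin (n + 1), (i : ℕ) = k ∧ x ∈ P i ∧ f x = h} := by
  have hD := hP.isDecomposition
  have huniq : ∀ {i j x}, x ∈ P i → x ∈ P j → i = j := by
    intro i j x hi hj
    by_contra hij
    exact (Set.ext_iff.1 (hD.disjoint i j hij) x).1 ⟨hi, hj⟩
  refine ⟨?_, ?_, ?_, ?_, ?_, ?_, ?_, ?_⟩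
  · rintro _ _ ⟨x, i, rfl, hx, rfl⟩
    exact hf.nonneg x
  · rintro _ _ ⟨x, i, rfl, hx, rfl⟩
    exact hf.le x
  · rintro _ _ ⟨x, i, rfl, hx, rfl⟩
    omega
  · intro h h0 he
    obtain ⟨x, rfl⟩ := hf.exists_eq h h0 he
    obtain ⟨i, hi⟩ := Set.mem_iUnion.1 (hD.iUnion_eq ▸ Set.mem_univ x)
    exact ⟨i, x, i, rfl, hi, rfl⟩
  · rintro _ _ _ ⟨x, i, rfl, hx, rfl⟩ ⟨y, j, rfl, hy, hxy⟩
    rw [hf.injective hxy] at hy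
    rw [huniq hx hy]
  · rintro _ _ _ _ ⟨x, i, rfl, hx, rfl⟩ ⟨y, j, rfl, hy, rfl⟩ hle
    obtain ⟨s, hs, hfs⟩ := hf.exists_padd hle
    obtain ⟨k, hk, hsk⟩ := hD.padd_mem i j x y s hx hy hs
    exact ⟨s, k, hk, hsk, hfs⟩
  · rintro _ _ _ _ ⟨x, i, rfl, hx, rfl⟩ ⟨y, j, rfl, hy, rfl⟩ heq
    rw [← hf.map_one, ← hf.padd_iff] at heq
    have h := huniq hy ((hD.mem_iff_of_padd_eq_one i x y heq).1.1 hx)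
    rw [h, Fin.val_rev]
    omega
  · rintro _ _ _ _ ⟨x, i, rfl, hx, rfl⟩ ⟨y, j, rfl, hy, rfl⟩ hij
    obtain ⟨s, hs⟩ := hP.exists_padd i j hij x hx y hy
    rw [(hf.padd_iff x y s).1 hs]
    exact hf.le s

namespace IsSlicing

variable {H : Type v} [AddGroup H] [PartialOrder H] [AddLeftMono H] [AddRightMono H]
  {n : ℕ} {e : H} {A : ℕ → Set H}

/-- Indices add along `y = x + (-x + y)`, so both summands have index `0`. -/
theorem mem_zero_of_le (hA : IsSlicing n e A) {x y : H} (hy : y ∈ A 0) (hx : 0 ≤ x)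
    (hxy : x ≤ y) : x ∈ A 0 := by
  obtain ⟨i, hi⟩ := hA.exists_mem x hx (hxy.trans (hA.le hy))
  obtain ⟨j, hj⟩ := hA.exists_mem (-x + y) (by rwa [le_neg_add_iff_add_le, add_zero])
    ((add_le_of_nonpos_left (neg_nonpos.2 hx)).trans (hA.le hy))
  have h := hA.add_mem hi hj (by rw [add_neg_cancel_left]; exact hA.le hy)
  rw [add_neg_cancel_left] at h
  have := hA.index_unique h hy
  obtain rfl : i = 0 := by omega
  exact hi

theorem zero_mem (hA : IsSlicing n e A) (he : 0 ≤ e) : (0 : H) ∈ A 0 := by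
  obtain ⟨i, hi⟩ := hA.exists_mem 0 le_rfl he
  have h := hA.add_mem hi hi (by rwa [add_zero])
  rw [add_zero] at h
  have := hA.index_unique h hi
  obtain rfl : i = 0 := by omega
  exact hi

theorem add_mem_zero (hA : IsSlicing n e A) (hn : 1 ≤ n) {x y : H} (hx : x ∈ A 0) (hy : y ∈ A 0) :
    x + y ∈ A 0 :=
  hA.add_mem hx hy (hA.add_le hx hy (by omega))

/-- Elements of a lower slice are below all elements of a higher slice. -/
theorem le_of_index_lt (hA : IsSlicing n e A) {i j : ℕ} {x y : H} (hx : x ∈ A i) (hy : y ∈ A j)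
    (hij : i < j) : x ≤ y := by
  obtain ⟨k, hk⟩ := hA.exists_mem (-y + e)
    (by rw [le_neg_add_iff_add_le, add_zero]; exact hA.le hy)
    (add_le_of_nonpos_left (neg_nonpos.2 (hA.nonneg hy)))
  -- The complement of `y` has index `n - j`, and `i + (n - j) < n`; hence `x + (-y + e) ≤ e`, and
  -- `e` cancels.
  have h1 := hA.index_compl hy hk (add_neg_cancel_left y e)
  have h2 := hA.add_le hx hk (by omega)
  rw [← add_assoc, add_le_iff_nonpos_left, ← sub_eq_add_neg, sub_nonpos] at h2
  exact h2

/-- The subgroup generated by the slice `A 0`. -/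
def differenceSubgroup (hA : IsSlicing n e A) (hn : 1 ≤ n) (he : 0 ≤ e) : AddSubgroup H where
  carrier := {g | ∃ x ∈ A 0, ∃ y ∈ A 0, g = x - y}
  zero_mem' := ⟨0, hA.zero_mem he, 0, hA.zero_mem he, (sub_zero 0).symm⟩
  neg_mem' := by
    rintro _ ⟨x, hx, y, hy, rfl⟩
    exact ⟨y, hy, x, hx, neg_sub x y⟩
  add_mem' := by
    rintro _ _ ⟨x, hx, y, hy, rfl⟩ ⟨x', hx', y', hy', rfl⟩
    -- Conjugating `x'` by `y` replaces commutativity: the conjugate is positive and lies below `x'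
    -- + y`.
    have hp : -y + (x' + y) ∈ A 0 := by
      refine hA.mem_zero_of_le (hA.add_mem_zero hn hx' hy) ?_
        (add_le_of_nonpos_left (neg_nonpos.2 (hA.nonneg hy)))
      rw [le_neg_add_iff_add_le, add_zero]
      exact le_add_of_nonneg_left (hA.nonneg hx')
    refine ⟨x + (-y + (x' + y)), hA.add_mem_zero hn hx hp, y' + y, hA.add_mem_zero hn hy' hy, ?_⟩
    simp only [sub_eq_add_neg, neg_add_rev, add_assoc, add_neg_cancel_left]

variable (hA : IsSlicing n e A) (hn : 1 ≤ n) (he : 0 ≤ e)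

theorem mem_of_mem_zero {x : H} (hx : x ∈ A 0) : x ∈ hA.differenceSubgroup hn he :=
  ⟨x, hx, 0, hA.zero_mem he, (sub_zero x).symm⟩

/-- Since `x - y ≤ x`, downward closure applies. With `mem_of_mem_zero`, the positive cone of the
difference group is exactly `A 0`. -/
theorem mem_zero_of_nonneg {g : H} (hg : g ∈ hA.differenceSubgroup hn he) (h0 : 0 ≤ g) :
    g ∈ A 0 := by
  obtain ⟨x, hx, y, hy, rfl⟩ := hg
  exact hA.mem_zero_of_le hx h0 (sub_le_self x (hA.nonneg hy))

instance : AddLeftMono (hA.differenceSubgroup hn he) where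
  elim a b c h := add_le_add_right (α := H) (show (b : H) ≤ c from h) (a : H)

instance : AddRightMono (hA.differenceSubgroup hn he) where
  elim a b c h := add_le_add_left (α := H) (show (b : H) ≤ c from h) (a : H)

instance : IsDirectedOrder (hA.differenceSubgroup hn he) where
  directed := by
    rintro ⟨_, x, hx, y, hy, rfl⟩ ⟨_, x', hx', y', hy', rfl⟩
    refine ⟨⟨x + x', hA.mem_of_mem_zero hn he (hA.add_mem_zero hn hx hx')⟩, ?_, ?_⟩
    · exact (sub_le_self x (hA.nonneg hy)).trans (le_add_of_nonneg_right (hA.nonneg hx'))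
    · exact (sub_le_self x' (hA.nonneg hy')).trans (le_add_of_nonneg_left (hA.nonneg hx))

theorem torsionFree (hH : POGroup.TorsionFree H) :
    POGroup.TorsionFree (hA.differenceSubgroup hn he) := by
  intro g hg k hk h
  refine hH g (fun h0 => hg (Subtype.ext h0)) k hk ?_
  exact congrArg Subtype.val h

/-- `RDP₁` for sums in the interval `[0, e]` of a po-group. -/
def IntervalRDP1 (e : H) : Prop :=
  ∀ a₁ a₂ b₁ b₂ : H, 0 ≤ a₁ → 0 ≤ a₂ → 0 ≤ b₁ → 0 ≤ b₂ → a₁ + a₂ = b₁ + b₂ → a₁ + a₂ ≤ e →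
    ∃ c₁₁ c₁₂ c₂₁ c₂₂ : H, 0 ≤ c₁₁ ∧ 0 ≤ c₁₂ ∧ 0 ≤ c₂₁ ∧ 0 ≤ c₂₂ ∧
      a₁ = c₁₁ + c₁₂ ∧ a₂ = c₂₁ + c₂₂ ∧ b₁ = c₁₁ + c₂₁ ∧ b₂ = c₁₂ + c₂₂ ∧
      ∀ x y : H, 0 ≤ x → x ≤ c₁₂ → 0 ≤ y → y ≤ c₂₁ → x + y = y + x

theorem _root_.IsIntervalRep.intervalRDP1 {E : Type u} [PseudoEffectAlgebra E] {f : E → H}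
    (hf : IsIntervalRep e f) (hE : PseudoEffectAlgebra.RDP1 E) : IntervalRDP1 e := by
  intro a₁ a₂ b₁ b₂ ha1 ha2 hb1 hb2 h hle
  obtain ⟨a₁, rfl⟩ := hf.exists_eq a₁ ha1 ((le_add_of_nonneg_right ha2).trans hle)
  obtain ⟨a₂, rfl⟩ := hf.exists_eq a₂ ha2 ((le_add_of_nonneg_left ha1).trans hle)
  obtain ⟨b₁, rfl⟩ := hf.exists_eq b₁ hb1 ((le_add_of_nonneg_right hb2).trans (h ▸ hle))
  obtain ⟨b₂, rfl⟩ := hf.exists_eq b₂ hb2 ((le_add_of_nonneg_left hb1).trans (h ▸ hle))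
  obtain ⟨s, hs, hfs⟩ := hf.exists_padd hle
  obtain ⟨c₁₁, c₁₂, c₂₁, c₂₂, h1, h2, h3, h4, hc⟩ :=
    hE a₁ a₂ b₁ b₂ s hs ((hf.padd_iff _ _ _).2 (h.symm.trans hfs.symm))
  rw [hf.padd_iff] at h1 h2 h3 h4
  refine ⟨f c₁₁, f c₁₂, f c₂₁, f c₂₂, hf.nonneg _, hf.nonneg _, hf.nonneg _, hf.nonneg _,
    h1.symm, h2.symm, h3.symm, h4.symm, fun x y hx hx' hy hy' => ?_⟩
  obtain ⟨x, rfl⟩ := hf.exists_eq x hx (hx'.trans (hf.le _))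
  obtain ⟨y, rfl⟩ := hf.exists_eq y hy (hy'.trans (hf.le _))
  have hcomm := hc x y (hf.le_iff.2 hx') (hf.le_iff.2 hy')
  -- Equality of partial sums says something about `H` only once one of them is known to exist.
  have hxc : f x + f y ≤ e := by
    have hy2 : f y ≤ f a₂ := hy'.trans (h2 ▸ le_add_of_nonneg_right (hf.nonneg _))
    have hx1 : f x ≤ f a₁ := hx'.trans (h1 ▸ le_add_of_nonneg_left (hf.nonneg _))
    exact (add_le_add hx1 hy2).trans hle
  obtain ⟨t, ht, hft⟩ := hf.exists_padd hxc
  rw [hcomm, hf.padd_iff] at ht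
  rw [ht, hft]

/-- Sums of positive elements of the difference group stay in `A 0`, hence below `e`, so the
interval form of `RDP₁` suffices. -/
theorem rdp1 (hR : IntervalRDP1 e) : POGroup.RDP1 (hA.differenceSubgroup hn he) := by
  intro a₁ a₂ b₁ b₂ ha1 ha2 hb1 hb2 h
  have hm : ∀ g : hA.differenceSubgroup hn he, 0 ≤ g → (g : H) ∈ A 0 := fun g hg =>
    hA.mem_zero_of_nonneg hn he g.2 hg
  obtain ⟨c₁₁, c₁₂, c₂₁, c₂₂, h11, h12, h21, h22, e1, e2, e3, e4, hc⟩ :=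
    hR (a₁ : H) a₂ b₁ b₂ ha1 ha2 hb1 hb2 (congrArg Subtype.val h)
      (hA.le (hA.add_mem_zero hn (hm _ ha1) (hm _ ha2)))
  have m1 := hA.mem_zero_of_le (hm _ ha1) h11 (e1 ▸ le_add_of_nonneg_right h12)
  have m2 := hA.mem_zero_of_le (hm _ ha1) h12 (e1 ▸ le_add_of_nonneg_left h11)
  have m3 := hA.mem_zero_of_le (hm _ ha2) h21 (e2 ▸ le_add_of_nonneg_right h22)
  have m4 := hA.mem_zero_of_le (hm _ ha2) h22 (e2 ▸ le_add_of_nonneg_left h21)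
  exact ⟨⟨c₁₁, hA.mem_of_mem_zero hn he m1⟩, ⟨c₁₂, hA.mem_of_mem_zero hn he m2⟩,
    ⟨c₂₁, hA.mem_of_mem_zero hn he m3⟩, ⟨c₂₂, hA.mem_of_mem_zero hn he m4⟩, h11, h12, h21, h22,
    Subtype.ext e1, Subtype.ext e2, Subtype.ext e3, Subtype.ext e4,
    fun x y hx hx' hy hy' => Subtype.ext (hc x y hx hx' hy hy')⟩

/-! ### Splitting off multiples of the central element -/

variable {c : H}

theorem sub_add_sub_of_central (hc : ∀ x, c + x = x + c) (x y : H) (i j : ℕ) :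
    (x - i • c) + (y - j • c) = (x + y) - (i + j) • c := by
  have h : -(i • c) + y = y + -(i • c) :=
    ((show AddCommute c y from hc y).nsmul_left i).neg_left
  rw [sub_eq_add_neg, sub_eq_add_neg, sub_eq_add_neg, add_assoc, ← add_assoc _ y, h, add_assoc y,
    ← neg_add_rev, ← add_nsmul, add_comm j i, add_assoc]

/-- An element of the `i`-th slice differs from `i c` by an element of the difference group. -/
theorem sub_nsmul_mem_of_le (hR : IntervalRDP1 e) (hc1 : c ∈ A 1) (hc : ∀ x, c + x = x + c)
    (hce : n • c = e) (k : ℕ) : k ≤ n → ∀ {i : ℕ} {x : H}, x ∈ A i → x ≤ k • c →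
      x - i • c ∈ hA.differenceSubgroup hn he := by
  have hc0 := hA.nonneg hc1
  induction k with
  | zero =>
    intro _ i x hx hle
    rw [zero_nsmul] at hle
    obtain rfl := le_antisymm hle (hA.nonneg hx)
    obtain rfl := hA.index_unique hx (hA.zero_mem he)
    rw [zero_nsmul, sub_zero]
    exact ZeroMemClass.zero_mem _
  | succ k ih =>
    intro hk i x hx hle
    -- Refining `x + (-x + (k + 1) c) = c + k c` splits `x` into a part below `c` and a part below
    -- `k c`; the latter is handled by induction.
    obtain ⟨c₁₁, c₁₂, c₂₁, c₂₂, h11, h12, h21, h22, e1, -, e3, e4, -⟩ :=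
      hR x (-x + (k + 1) • c) c (k • c) (hA.nonneg hx)
        (by rwa [le_neg_add_iff_add_le, add_zero]) hc0 (nsmul_nonneg hc0 k)
        (by rw [add_neg_cancel_left, succ_nsmul'])
        (by rw [add_neg_cancel_left, ← hce]; exact nsmul_le_nsmul_left hc0 hk)
    have hkc : k • c ≤ e := hce ▸ nsmul_le_nsmul_left hc0 (by omega)
    have hle11 : c₁₁ ≤ c := e3 ▸ le_add_of_nonneg_right h21
    have hle21 : c₂₁ ≤ c := e3 ▸ le_add_of_nonneg_left h11
    have hle12 : c₁₂ ≤ k • c := e4 ▸ le_add_of_nonneg_right h22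
    obtain ⟨a, ha⟩ := hA.exists_mem c₁₁ h11 (hle11.trans (hA.le hc1))
    obtain ⟨b, hb⟩ := hA.exists_mem c₁₂ h12 (hle12.trans hkc)
    obtain ⟨d, hd⟩ := hA.exists_mem c₂₁ h21 (hle21.trans (hA.le hc1))
    have had : a + d = 1 := hA.index_unique (hA.add_mem ha hd (e3 ▸ hA.le hc1)) (e3 ▸ hc1)
    have hab : a + b = i := hA.index_unique (hA.add_mem ha hb (e1 ▸ hA.le hx)) (e1 ▸ hx)
    rw [e1, ← hab, ← sub_add_sub_of_central hc]
    refine AddMemClass.add_mem ?_ (ih (by omega) hb hle12)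
    -- Since `c = c₁₁ + c₂₁` has index `1`, one of the two lies in `A 0`. If it is `c₂₁`, centrality
    -- gives `c₁₁ - c = -c₂₁`.
    obtain ⟨rfl, rfl⟩ | ⟨rfl, rfl⟩ : a = 0 ∧ d = 1 ∨ a = 1 ∧ d = 0 := by omega
    · rw [zero_nsmul, sub_zero]
      exact hA.mem_of_mem_zero hn he ha
    · have h1 : c₁₁ - 1 • c = -c₂₁ := by
        have h2 : -c + c₁₁ = c₁₁ + -c := (show AddCommute c c₁₁ from hc c₁₁).neg_left
        rw [one_nsmul, sub_eq_add_neg, ← h2, e3, neg_add_rev, neg_add_cancel_right]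
      rw [h1]
      exact neg_mem (hA.mem_of_mem_zero hn he hd)

/-- Otherwise `k c` would lie in `A 0`, and so would `c ≤ k c`, although `c` has index `1`. Thus
multiples of `c` determine the level modulo the difference group. -/
theorem nsmul_notMem (hc1 : c ∈ A 1) {k : ℕ} (hk : 1 ≤ k) :
    k • c ∉ hA.differenceSubgroup hn he := by
  intro h
  have hc0 := hA.nonneg hc1
  have h1 := hA.mem_zero_of_nonneg hn he h (nsmul_nonneg hc0 k)
  have h2 : c ≤ k • c := by simpa using nsmul_le_nsmul_left hc0 hk
  exact absurd (hA.index_unique hc1 (hA.mem_zero_of_le h1 hc0 h2)) one_ne_zero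

theorem eq_of_nsmul_sub_nsmul_mem (hc1 : c ∈ A 1) {m i : ℕ}
    (h : m • c - i • c ∈ hA.differenceSubgroup hn he) : m = i := by
  rcases lt_trichotomy m i with hlt | heq | hlt
  · obtain ⟨d, rfl⟩ := Nat.exists_eq_add_of_lt hlt
    refine absurd (neg_mem h) ?_
    rw [neg_sub, add_assoc, add_comm m, add_nsmul, add_sub_cancel_right]
    exact hA.nsmul_notMem hn he hc1 (by omega)
  · exact heq
  · obtain ⟨d, rfl⟩ := Nat.exists_eq_add_of_lt hlt
    refine absurd h ?_
    rw [add_assoc, add_comm i, add_nsmul, add_sub_cancel_right]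
    exact hA.nsmul_notMem hn he hc1 (by omega)

/-- For `g` in the difference group with `(m, g)` in the interval `[0, (n, 0)]` of the
lexicographic product, the element `g + m c` lies in `[0, n c]`. -/
theorem add_nsmul_mem_interval (hc1 : c ∈ A 1) (hce : n • c = e)
    {g : H} (hg : g ∈ hA.differenceSubgroup hn he) {m : ℕ} (h0 : m = 0 → 0 ≤ g)
    (h1 : m < n ∨ m = n ∧ g ≤ 0) : 0 ≤ g + m • c ∧ g + m • c ≤ e := by
  have hc0 := hA.nonneg hc1
  obtain ⟨x, hx, y, hy, rfl⟩ := hg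
  constructor
  · rcases Nat.eq_zero_or_pos m with rfl | hm
    · rw [zero_nsmul, add_zero]
      exact h0 rfl
    · have h2 : y ≤ m • c := (hA.le_of_index_lt hy hc1 zero_lt_one).trans
        (by simpa using nsmul_le_nsmul_left hc0 hm)
      rw [sub_eq_add_neg, add_assoc]
      exact add_nonneg (hA.nonneg hx) (by rwa [le_neg_add_iff_add_le, add_zero])
  · rcases h1 with hm | ⟨rfl, hle⟩
    · calc x - y + m • c ≤ c + m • c := add_le_add_left
            ((sub_le_self x (hA.nonneg hy)).trans (hA.le_of_index_lt hx hc1 zero_lt_one)) _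
        _ = (m + 1) • c := (succ_nsmul' c m).symm
        _ ≤ e := hce ▸ nsmul_le_nsmul_left hc0 hm
    · rw [hce]
      exact add_le_of_nonpos_left hle

/-- The map is `x ↦ (i, f x - i c)`, with `i` the index of `x`. It is additive because indices add
and `c` is central; a pair `(m, g)` in the interval comes from `g + m c`. -/
theorem exists_isIntervalRep_lex {E : Type u} [PseudoEffectAlgebra E] {f : E → H}
    (hf : IsIntervalRep e f) (hR : IntervalRDP1 e) (hc1 : c ∈ A 1) (hc : ∀ x, c + x = x + c)
    (hce : n • c = e) :
    ∃ F : E → ℤ ×ₗ hA.differenceSubgroup hn he, IsIntervalRep (toLex ((n : ℤ), 0)) F := by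
  choose i hi using fun x => hA.exists_mem (f x) (hf.nonneg x) (hf.le x)
  have hmem : ∀ x, f x - i x • c ∈ hA.differenceSubgroup hn he := fun x =>
    hA.sub_nsmul_mem_of_le hn he hR hc1 hc hce n le_rfl (hi x) (hce ▸ hf.le x)
  have ext : ∀ {p q : ℤ ×ₗ hA.differenceSubgroup hn he}, (ofLex p).1 = (ofLex q).1 →
      ((ofLex p).2 : H) = (ofLex q).2 → p = q := fun h1 h2 =>
    ofLex.injective (Prod.ext h1 (Subtype.ext h2))
  refine ⟨fun x => toLex ((i x : ℤ), ⟨f x - i x • c, hmem x⟩), ?_, ?_, ?_, ?_, ?_, ?_⟩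
  · intro x y h
    have h1 : (i x : ℤ) = i y := congrArg (fun t => (ofLex t).1) h
    have h2 : f x - i x • c = f y - i y • c := congrArg (fun t => ((ofLex t).2 : H)) h
    rw [Int.ofNat_inj.1 h1] at h2
    exact hf.injective (sub_left_injective h2)
  · intro x
    refine Prod.Lex.le_iff.2 ?_
    rcases Nat.eq_zero_or_pos (i x) with h | h
    · refine Or.inr ⟨congrArg Nat.cast h.symm, ?_⟩
      change 0 ≤ f x - i x • c
      rw [h, zero_nsmul, sub_zero]
      exact hf.nonneg x
    · exact Or.inl (Int.natCast_pos.2 h)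
  · intro x
    refine Prod.Lex.le_iff.2 ?_
    rcases (hA.index_le (hi x)).lt_or_eq with h | h
    · exact Or.inl (Int.ofNat_lt.2 h)
    · refine Or.inr ⟨congrArg Nat.cast h, ?_⟩
      change f x - i x • c ≤ 0
      rw [h, hce, sub_nonpos]
      exact hf.le x
  · intro p hp0 hp1
    have hp0' := lex_nonneg_cases hp0
    obtain ⟨m, hm⟩ : ∃ m : ℕ, (m : ℤ) = (ofLex p).1 := Int.eq_ofNat_of_zero_le
      (by rcases hp0' with h | ⟨h, _⟩ <;> omega) |>.imp fun _ h => h.symm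
    have hg := (ofLex p).2.2
    obtain ⟨h0, h1⟩ := hA.add_nsmul_mem_interval hn he hc1 hce hg (m := m)
      (by
        rintro rfl
        rcases hp0' with h | ⟨_, h⟩
        · rw [← hm] at h
          exact absurd h (lt_irrefl _)
        · exact h)
      (by
        rcases Prod.Lex.le_iff.1 hp1 with h | ⟨h, h'⟩
        · exact Or.inl (Int.ofNat_lt.1 (hm.trans_lt h))
        · exact Or.inr ⟨Int.ofNat_inj.1 (hm.trans h), h'⟩)
    obtain ⟨x, hx⟩ := hf.exists_eq _ h0 h1
    -- The index chosen for the preimage is not `m` by construction, but `m c - i c` lies in the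
    -- difference group, which forces equality.
    have hix : m = i x := by
      refine hA.eq_of_nsmul_sub_nsmul_mem hn he hc1 ?_
      have h2 := AddMemClass.add_mem (neg_mem hg) (hmem x)
      rwa [hx, add_sub_assoc, neg_add_cancel_left] at h2
    refine ⟨x, ext ((congrArg Nat.cast hix.symm).trans hm) ?_⟩
    change f x - i x • c = (ofLex p).2
    rw [hx, hix, add_sub_cancel_right]
  · intro a b s
    rw [hf.padd_iff]
    constructor
    · intro h
      have hidx : i a + i b = i s :=
        hA.index_unique (hA.add_mem (hi a) (hi b) (h ▸ hf.le s)) (h ▸ hi s)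
      refine ext ((Nat.cast_add _ _).symm.trans (congrArg (Nat.cast : ℕ → ℤ) hidx)) ?_
      change f a - i a • c + (f b - i b • c) = f s - i s • c
      rw [sub_add_sub_of_central hc, h, hidx]
    · intro h
      have h1 : (i a : ℤ) + i b = i s := congrArg (fun t => (ofLex t).1) h
      have h2 : f a - i a • c + (f b - i b • c) = f s - i s • c :=
        congrArg (fun t => ((ofLex t).2 : H)) h
      rw [sub_add_sub_of_central hc, show i a + i b = i s by omega] at h2
      exact sub_left_injective h2
  -- The unit is complementary to `0`, so its index is `n`.
  · have h1 : i 1 + 0 = n :=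
      hA.index_compl (hi 1) (hA.zero_mem he) (by rw [hf.map_one, add_zero])
    rw [add_zero] at h1
    refine ext (congrArg Nat.cast h1) ?_
    change f 1 - i 1 • c = 0
    rw [h1, hf.map_one, hce, sub_self]

end IsSlicing

/-! ### Assembling the representation theorem -/

theorem exists_lexGamma_of_isStrongPerfect {E : Type u} [PseudoEffectAlgebra E] {n : ℕ}
    (hn : 1 ≤ n) (hE : IsStrongPerfect n E) :
    ∃ (G : Type u) (_ : AddGroup G) (_ : PartialOrder G) (_ : AddLeftMono G)
      (_ : AddRightMono G), POGroup.TorsionFree G ∧ IsDirectedOrder G ∧ POGroup.RDP1 G ∧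
        Nonempty (Iso E (LexGamma n G)) := by
  obtain ⟨P, hP, hR, H, _, _, _, _, e, he, φ, hH, c, hcP, hce, hc⟩ := hE
  have hf := IsIntervalRep.of_iso φ
  have hA := hf.isSlicing hP
  have hR' := hf.intervalRDP1 hR
  have h1 : ((1 : Fin (n + 1)) : ℕ) = 1 := by
    obtain ⟨m, rfl⟩ := Nat.exists_eq_add_of_le' hn
    rfl
  obtain ⟨F, hF⟩ := hA.exists_isIntervalRep_lex hn he.nonneg hf hR' ⟨c, 1, h1, hcP, rfl⟩ hc hce
  exact ⟨hA.differenceSubgroup hn he.nonneg, inferInstance, inferInstance, inferInstance,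
    inferInstance, hA.torsionFree hn he.nonneg hH, inferInstance, hA.rdp1 hn he.nonneg hR',
    hF.nonempty_iso _⟩

theorem theorem4p1 (E : Type u) [PseudoEffectAlgebra E] (n : ℕ) (hn : 1 ≤ n) :
    (PseudoEffectAlgebra.IsStrongPerfect n E ↔
      ∃ (G : Type u) (_ : AddGroup G) (_ : PartialOrder G) (_ : AddLeftMono G)
        (_ : AddRightMono G),
        POGroup.TorsionFree G ∧ IsDirectedOrder G ∧ POGroup.RDP1 G ∧
          Nonempty (PseudoEffectAlgebra.Iso E (POGroup.LexGamma n G))) ∧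
    ∀ (G : Type v) [AddGroup G] [PartialOrder G] [AddLeftMono G] [AddRightMono G]
      (G' : Type w) [AddGroup G'] [PartialOrder G'] [AddLeftMono G'] [AddRightMono G'],
      POGroup.TorsionFree G → IsDirectedOrder G → POGroup.RDP1 G →
      Nonempty (PseudoEffectAlgebra.Iso E (POGroup.LexGamma n G)) →
      POGroup.TorsionFree G' → IsDirectedOrder G' → POGroup.RDP1 G' →
      Nonempty (PseudoEffectAlgebra.Iso E (POGroup.LexGamma n G')) →
      Nonempty (G ≃+o G') := by
  refine ⟨⟨exists_lexGamma_of_isStrongPerfect hn, ?_⟩, ?_⟩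
  · rintro ⟨G, _, _, _, _, htf, _, hG, ⟨φ⟩⟩
    exact isStrongPerfect_of_lexGamma hn htf hG φ
  · intro G _ _ _ _ G' _ _ _ _ _ _ _ ⟨φ⟩ _ _ _ ⟨ψ⟩
    exact nonempty_orderAddMonoidIso_of_lexGamma hn φ ψ
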